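/- Let $\mathbb T=\mathbb R/\mathbb Z$ be equipped with unit Lebesgue measure $|\cdot|$, and for $f\in L^1(\mathbb T)$ and $n\in\mathbb Z$ let $\widehat f(n)=\int_{\mathbb T} f(t)e^{-2\pi i n t}\,dt$. Let $A\subseteq\mathbb T$ be Lebesgue measurable, and let $L^2(A)$ be the set of functions in $L^2(\mathbb T)$ that vanish a.e. outside $A$. A set $S\subseteq\mathbb Z$ is *complete for $A$* if $\{f\mathbf 1_A : f\in L^2(\mathbb T),\ \widehat f(n)=0 \text{ for all } n\in\mathbb Z\setminus S\}$ is dense in $L^2(A)$. For an interval of integers $[a,b]\subset\mathbb Z\setminus\{0\}$, let $\alpha([a,b])=\max\{|a|,|b|\}/\min\{|a|,|b|\}$. The *Beurling–Malliavin density* $\mathrm{BM}(S)$ of $S\subseteq\mathbb Z$ is the supremum of those $D\ge 0$ for which there are disjoint nonempty intervals of integers $I_n\subset\mathbb Z\setminus\{0\}$ $(n\ge 1)$ with $|S\cap I_n|\ge D|I_n|$ for all $n$ and $\sum_{n\ge1}[\alpha(I_n)-1]^2=\infty$, where $|\cdot|$ of a set of integers is its cardinality. Then there is a set $S\subseteq\mathbb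 Z$ with $\mathrm{BM}(S)=|A|$ that is complete for $A$. Indeed, there is a unique probability measure $\mathbf P^A$ on $2^{\mathbb Z}$ (with the product $\sigma$-algebra) such that $$\mathbf P^A[\{S : F\subseteq S\}]=\det\big(\widehat{\mathbf 1_A}(k-j)\big)_{j,k\in F}\qquad\text{for all finite } F\subset\mathbb Z,$$ and $\mathbf P^A$-a.e. $S\subseteq\mathbb Z$ is complete for $A$ and has $\mathrm{BM}(S)=|A|$. -/

import Mathlib

open MeasureTheory

noncomputable section

/-- A Borel measure `P` on `2^E` (subsets of `E` with the product σ-algebra) is the determinantal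
probability measure of the matrix `Q` if it is a probability measure and
`P[F ⊆ S] = det (Q restricted to F)` for all finite `F ⊆ E`. -/
structure IsDeterminantal {E : Type*} [DecidableEq E] (P : Measure (Set E))
    (Q : Matrix E E ℂ) : Prop where
  isProbabilityMeasure : IsProbabilityMeasure P
  det_eq : ∀ F : Finset E, ((P.real {S : Set E | (F : Set E) ⊆ S} : ℝ) : ℂ) =
    (Q.submatrix (fun i : F => (i : E)) (fun i : F => (i : E))).det

/-- The unit Lebesgue measure on the circle `ℝ / ℤ`. -/
abbrev circleMeasure : Measure UnitAddCircle := AddCircle.haarAddCircle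

/-- The Toeplitz matrix `(j, k) ↦ (1_A)^(k - j)`. -/
def toeplitzIndicator (A : Set UnitAddCircle) : Matrix ℤ ℤ ℂ :=
  Matrix.of fun j k => fourierCoeff (A.indicator (fun _ => (1 : ℂ))) (k - j)

/-- `L²(A)`: the functions in `L²(ℝ / ℤ)` that vanish (a.e.) outside `A`. -/
def L2On (A : Set UnitAddCircle) : Set (Lp ℂ 2 circleMeasure) :=
  {g | ∀ᵐ t ∂circleMeasure, t ∉ A → g t = 0}

/-- `S ⊆ ℤ` is complete for `A` if the set of all `f 1_A`, where `f ∈ L²(ℝ / ℤ)` has Fourier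
coefficients vanishing off `S`, is dense in `L²(A)`. -/
def IsCompleteFor (S : Set ℤ) (A : Set UnitAddCircle) : Prop :=
  Dense {h : L2On A | ∃ f : Lp ℂ 2 circleMeasure,
    (∀ n : ℤ, n ∉ S → fourierCoeff f n = 0) ∧
      (h : Lp ℂ 2 circleMeasure) =ᵐ[circleMeasure] A.indicator f}

/-- The aspect of an integer interval `[a, b]` not containing `0`. -/
def aspect (a b : ℤ) : ℝ :=
  max |(a : ℝ)| |(b : ℝ)| / min |(a : ℝ)| |(b : ℝ)|

/-- The `D ≥ 0` for which there are disjoint nonempty integer intervals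
`I n = [a n, b n] ⊆ ℤ \ {0}` with `|S ∩ I n| ≥ D |I n|` for all `n` and
`∑ (aspect (I n) - 1)² = ∞` (the terms are nonnegative, so this is non-summability). -/
def bmSet (S : Set ℤ) : Set ℝ :=
  {D | 0 ≤ D ∧ ∃ a b : ℕ → ℤ,
    (∀ n, a n ≤ b n ∧ (0 : ℤ) ∉ Set.Icc (a n) (b n)) ∧
    Pairwise (fun m n => Disjoint (Set.Icc (a m) (b m)) (Set.Icc (a n) (b n))) ∧
    (∀ n, D * ((Set.Icc (a n) (b n)).ncard : ℝ) ≤ ((S ∩ Set.Icc (a n) (b n)).ncard : ℝ)) ∧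
    ¬ Summable (fun n => (aspect (a n) (b n) - 1) ^ 2)}

/-- The Beurling–Malliavin density of `S ⊆ ℤ`. -/
def bmDensity (S : Set ℤ) : ℝ := sSup (bmSet S)

/-- The supremum defining the density is taken over a nonempty set. -/
theorem zero_mem_bmSet (S : Set ℤ) : (0 : ℝ) ∈ bmSet S := by
  have h4 : ∀ n : ℕ, (0 : ℤ) < 4 ^ n := fun n => by positivity
  refine ⟨le_rfl, fun n => 4 ^ n, fun n => 2 * 4 ^ n, fun n => ⟨?_, ?_⟩, ?_, fun n => ?_, ?_⟩
  · have := h4 n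
    linarith
  · rintro ⟨h, -⟩
    have := h4 n
    exact absurd h (not_le.2 this)
  · have key : ∀ m n : ℕ, m < n →
        Disjoint (Set.Icc ((4 : ℤ) ^ m) (2 * 4 ^ m)) (Set.Icc ((4 : ℤ) ^ n) (2 * 4 ^ n)) := by
      intro m n hmn
      rw [Set.disjoint_left]
      rintro x ⟨-, hx⟩ ⟨hx', -⟩
      have h1 : (4 : ℤ) ^ (m + 1) ≤ 4 ^ n := pow_le_pow_right₀ (by norm_num) hmn
      rw [pow_succ] at h1
      have := h4 m
      linarith
    intro m n hmn
    rcases lt_or_gt_of_ne hmn with h | h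
    · exact key m n h
    · exact (key n m h).symm
  · simp
  · have : (fun n : ℕ => (aspect (4 ^ n) (2 * 4 ^ n) - 1) ^ 2) = fun _ => (1 : ℝ) := by
      funext n
      have h : (0 : ℝ) < 4 ^ n := by positivity
      have e : aspect (4 ^ n) (2 * 4 ^ n) = 2 := by
        unfold aspect
        push_cast
        rw [abs_of_pos h, abs_of_pos (by positivity), max_eq_right (by linarith),
          min_eq_left (by linarith)]
        field_simp
      rw [e]
      norm_num
    rw [this]
    simp [summable_const_iff]

/-- The supremum defining the density is taken over a set bounded above by `1`. -/
theorem bmSet_le_one (S : Set ℤ) {D : ℝ} (hD : D ∈ bmSet S) : D ≤ 1 := by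
  obtain ⟨-, a, b, hab, -, h, -⟩ := hD
  have hpos : (0 : ℝ) < ((Set.Icc (a 0) (b 0)).ncard : ℝ) := by
    exact_mod_cast (Set.ncard_pos (Set.finite_Icc _ _)).2 (Set.nonempty_Icc.2 (hab 0).1)
  have hle : ((S ∩ Set.Icc (a 0) (b 0)).ncard : ℝ) ≤ ((Set.Icc (a 0) (b 0)).ncard : ℝ) := by
    exact_mod_cast Set.ncard_le_ncard Set.inter_subset_right (Set.finite_Icc _ _)
  have h0 := h 0
  by_contra hlt
  push Not at hlt
  nlinarith

end

/-! Let `P` be multiplication by the indicator of `A` on `L²`, an orthogonal projection, and `b` the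
Fourier basis. Writing rows of `P` at indices in `B` and rows of `1 - P` at the others gives a
determinant, `weight`, that should be the probability that the process agrees with `B` on a finite
set `K`.

One linear-algebra fact drives everything. Let `y` and `d` be the weights of `B` on `K` and on
`insert e K`, with `e ∉ B`. If `P h = h` and `h` is orthogonal to `b i` for `i ∈ K ∩ B`, then `|⟪b
e, h⟫|² d ≤ ‖tail of h‖² (y - d)` (`realWeight_bound`), where the tail is the part of `h` outside
`insert e K`. Its proof, with an adjugate column as test vector, also yields `d ≥ 0`, so the weights
define a measure, found by compactness.

Completeness: if `h = P h` is orthogonal to `b i` for all `i ∈ S` but not to `b e`, then `e ∉ S`,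
and as `K` grows the tail tends to `0`, so the bound makes such a configuration have probability at
most any `ε`. Hence almost surely no nonzero `h` exists (`ae_eq_zero_of_inner_eq_zero`), which by
duality is completeness.

Density: the same bound with `h = b e - P (b e)` gives the Hadamard inequality `P[F ⊆ S] ≤ p ^ |F|`
with `p = |A|`, and likewise for the complement with `1 - p`. Chernoff and Borel–Cantelli then pin
down the density (`ae_bmDensity_eq`). -/

open MeasureTheory Filter Topology
open scoped InnerProductSpace

/-! ### Cylinder weights of a projection: positivity and the basic inequality. -/

noncomputable section Weights

/-- Replacing the row of `e` by the unit vector amounts to deleting the index `e`. -/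
theorem det_updateRow_single_insert {E R : Type*} [DecidableEq E] [CommRing R] (M : Matrix E E R)
    (K : Finset E) {e : E} (he : e ∉ K) :
    ((M.submatrix (Subtype.val : ↥(insert e K) → E) Subtype.val).updateRow
      ⟨e, Finset.mem_insert_self e K⟩ (Pi.single ⟨e, Finset.mem_insert_self e K⟩ 1)).det =
    (M.submatrix (Subtype.val : K → E) Subtype.val).det := by
  let ψ : K ⊕ PUnit.{1} ≃ ↥(insert e K) :=
    ((Finset.subtypeInsertEquivOption he).trans (Equiv.optionEquivSumPUnit.{0} _)).symm
  have h1 : ∀ i : K, ψ (Sum.inl i) = ⟨i, Finset.mem_insert_of_mem i.2⟩ := fun i => rfl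
  have h2 : ∀ i, ψ (Sum.inr i) = ⟨e, Finset.mem_insert_self e K⟩ := fun i => rfl
  have hne : ∀ i : K, (⟨i, Finset.mem_insert_of_mem i.2⟩ : ↥(insert e K)) ≠
      ⟨e, Finset.mem_insert_self e K⟩ := fun i h => he (by
    have := congrArg Subtype.val h
    simp only at this
    exact this ▸ i.2)
  rw [← Matrix.det_submatrix_equiv_self ψ,
    ← Matrix.fromBlocks_toBlocks (Matrix.submatrix _ ψ ψ)]
  have h21 : ((((M.submatrix (Subtype.val : ↥(insert e K) → E) Subtype.val).updateRow
      ⟨e, Finset.mem_insert_self e K⟩ (Pi.single ⟨e, Finset.mem_insert_self e K⟩ 1)).submatrix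
      ψ ψ).toBlocks₂₁) = 0 := by
    ext i j
    simp [Matrix.toBlocks₂₁, h1, h2, hne]
  rw [h21, Matrix.det_fromBlocks_zero₂₁]
  have h22 : ((((M.submatrix (Subtype.val : ↥(insert e K) → E) Subtype.val).updateRow
      ⟨e, Finset.mem_insert_self e K⟩ (Pi.single ⟨e, Finset.mem_insert_self e K⟩ 1)).submatrix
      ψ ψ).toBlocks₂₂) = 1 := by
    ext i j
    simp [Matrix.toBlocks₂₂, h2]
  rw [h22, Matrix.det_one, mul_one]
  congr 1
  ext i j
  simp [Matrix.toBlocks₁₁, h1, Matrix.updateRow_apply, hne]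

variable {E V : Type*} [NormedAddCommGroup V] [InnerProductSpace ℂ V]

/-- The orthogonal projection onto the span of finitely many vectors of an orthonormal family. -/
def partialSum (b : E → V) (J : Finset E) (v : V) : V := ∑ i ∈ J, ⟪b i, v⟫_ℂ • b i

theorem inner_partialSum {b : E → V} (hb : Orthonormal ℂ b) (J : Finset E) (v : V) {i : E}
    (hi : i ∈ J) : ⟪b i, partialSum b J v⟫_ℂ = ⟪b i, v⟫_ℂ :=
  hb.inner_right_sum _ hi

/-- Parseval with the remainder kept as a vector, so that `b` need not be complete. -/
theorem inner_eq_sum_add {b : E → V} (hb : Orthonormal ℂ b) (J : Finset E) (v w : V) :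
    ⟪v, w⟫_ℂ = ∑ i ∈ J, ⟪v, b i⟫_ℂ * ⟪b i, w⟫_ℂ +
      ⟪v - partialSum b J v, w - partialSum b J w⟫_ℂ := by
  have h1 : ⟪partialSum b J v, w - partialSum b J w⟫_ℂ = 0 := by
    conv_lhs => rw [partialSum, sum_inner]
    refine Finset.sum_eq_zero fun i hi => ?_
    rw [inner_smul_left, inner_sub_right, inner_partialSum hb J w hi, sub_self, mul_zero]
  have h2 : ⟪v, partialSum b J w⟫_ℂ = ∑ i ∈ J, ⟪v, b i⟫_ℂ * ⟪b i, w⟫_ℂ := by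
    rw [partialSum, inner_sum]
    exact Finset.sum_congr rfl fun i _ => by rw [inner_smul_right, mul_comm]
  rw [inner_sub_left, h1, inner_sub_right, h2]
  ring

theorem norm_sub_partialSum_sq {b : E → V} (hb : Orthonormal ℂ b) (J : Finset E) (v : V) :
    ((‖v - partialSum b J v‖ : ℂ)) ^ 2 = (‖v‖ : ℂ) ^ 2 - ∑ i ∈ J, (‖⟪b i, v⟫_ℂ‖ : ℂ) ^ 2 := by
  have := inner_eq_sum_add hb J v v
  rw [inner_self_eq_norm_sq_to_K, inner_self_eq_norm_sq_to_K] at this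
  have h : ∀ i, ⟪v, b i⟫_ℂ * ⟪b i, v⟫_ℂ = (‖⟪b i, v⟫_ℂ‖ : ℂ) ^ 2 := fun i => by
    rw [← inner_conj_symm, ← Complex.normSq_eq_conj_mul_self, Complex.normSq_eq_norm_sq]
    norm_cast
  simp only [h] at this
  simp only [Complex.coe_algebraMap] at this
  rw [this]
  ring

variable [DecidableEq E]

open scoped Classical in
/-- The matrix whose rows indexed by `B` are those of the compression of `P`, and whose other rows
are those of the compression of `1 - P`. -/
def mixedMatrix (b : E → V) (P : V →L[ℂ] V) (B : Set E) : Matrix E E ℂ :=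
  Matrix.of fun i j => if i ∈ B then ⟪b i, P (b j)⟫_ℂ else ⟪b i, b j - P (b j)⟫_ℂ

/-- The probability that the determinantal process of `P` agrees with `B` on `K`. -/
def weight (b : E → V) (P : V →L[ℂ] V) (K : Finset E) (B : Set E) : ℂ :=
  ((mixedMatrix b P B).submatrix (Subtype.val : K → E) Subtype.val).det

theorem weight_congr (b : E → V) (P : V →L[ℂ] V) {K : Finset E} {B B' : Set E}
    (h : ∀ i ∈ K, (i ∈ B ↔ i ∈ B')) : weight b P K B = weight b P K B' := by
  unfold weight
  congr 1
  ext i j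
  have := h i i.2
  by_cases hi : (i : E) ∈ B
  · simp [mixedMatrix, hi, this.1 hi]
  · simp [mixedMatrix, hi, mt this.2 hi]

theorem weight_empty (b : E → V) (P : V →L[ℂ] V) (B : Set E) : weight b P ∅ B = 1 := by
  simp [weight]

theorem weight_compl (b : E → V) (P : V →L[ℂ] V) (K : Finset E) (B : Set E) :
    weight b (1 - P) K Bᶜ = weight b P K B := by
  unfold weight
  congr 1
  ext i j
  by_cases hi : (i : E) ∈ B <;> simp [mixedMatrix, hi]

theorem weight_self (b : E → V) (P : V →L[ℂ] V) (K : Finset E) :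
    weight b P K K = Matrix.det (Matrix.of fun i j : K => ⟪b i, P (b j)⟫_ℂ) := by
  unfold weight
  congr 1
  ext i j
  simp [mixedMatrix]

/-- The determinant is additive in row `e`, and the rows of `P` and `1 - P` add up to a row of the
identity, which deletes `e`. -/
theorem weight_insert_add {b : E → V} (hb : Orthonormal ℂ b) (P : V →L[ℂ] V) {K : Finset E} {e : E}
    (he : e ∉ K) (B : Set E) :
    weight b P (insert e K) (insert e B) + weight b P (insert e K) (B \ {e}) = weight b P K B := by
  unfold weight
  rw [← det_updateRow_single_insert _ K he]
  set e' : ↥(insert e K) := ⟨e, Finset.mem_insert_self e K⟩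
  have key : ∀ (r : Set E) (_ : ∀ i : E, i ≠ e → (i ∈ r ↔ i ∈ B)),
      ((mixedMatrix b P r).submatrix (Subtype.val : ↥(insert e K) → E) Subtype.val) =
      ((mixedMatrix b P B).submatrix (Subtype.val : ↥(insert e K) → E) Subtype.val).updateRow
        e' (fun j : ↥(insert e K) => mixedMatrix b P r e j) := by
    intro r hr
    ext i j
    by_cases hi : i = e'
    · subst hi
      simp [e']
    · have : (i : E) ≠ e := fun h => hi (Subtype.ext h)
      have h := hr i this
      by_cases hB : (i : E) ∈ B
      · simp [Matrix.updateRow_apply, hi, mixedMatrix, hB, h.2 hB]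
      · simp [Matrix.updateRow_apply, hi, mixedMatrix, hB, mt h.1 hB]
  rw [key (insert e B) (fun i hi => by simp [hi]), key (B \ {e}) (fun i hi => by simp [hi]),
    ← Matrix.det_updateRow_add]
  congr 2
  ext j
  have : (j = e') ↔ (e = (j : E)) := by
    rw [Subtype.ext_iff, eq_comm]
  simp only [mixedMatrix, Matrix.of_apply, Set.mem_insert_iff, true_or, if_true, Set.mem_sdiff,
    Set.mem_singleton_iff, not_true_eq_false, and_false, if_false, Pi.add_apply, ← inner_add_right,
    add_sub_cancel, Pi.single_apply, orthonormal_iff_ite.1 hb, this]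

/-- `P` is an orthogonal projection. -/
structure IsOrthProj (P : V →L[ℂ] V) : Prop where
  symm : ∀ x y, ⟪P x, y⟫_ℂ = ⟪x, P y⟫_ℂ
  idem : ∀ x, P (P x) = P x

theorem IsOrthProj.one_sub {P : V →L[ℂ] V} (hP : IsOrthProj P) : IsOrthProj (1 - P) where
  symm x y := by simp [hP.symm]
  idem x := by simp [hP.idem]

/-- The vectors given by the column of the adjugate matrix. -/
theorem exists_adjugate_vectors {b : E → V} (hb : Orthonormal ℂ b) {P : V →L[ℂ] V}
    (hP : IsOrthProj P) {K : Finset E} {e : E} (he : e ∉ K) {B : Set E} (heB : e ∉ B) :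
    ∃ u w : V, P u = u ∧ P w = 0 ∧ (∀ i ∈ K, i ∈ B → ⟪b i, u⟫_ℂ = 0) ∧
      (∀ i ∈ K, i ∉ B → ⟪b i, w⟫_ℂ = 0) ∧ ⟪b e, w⟫_ℂ = weight b P (insert e K) B ∧
      ⟪b e, u⟫_ℂ = weight b P K B - weight b P (insert e K) B ∧
      w - partialSum b (insert e K) w = - (u - partialSum b (insert e K) u) := by
  set e' : ↥(insert e K) := ⟨e, Finset.mem_insert_self e K⟩ with he'
  set M := (mixedMatrix b P B).submatrix (Subtype.val : ↥(insert e K) → E) Subtype.val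
    with hM
  set y : ↥(insert e K) → ℂ := fun i => M.adjugate i e' with hy
  have hMy : ∀ i, ∑ j, M i j * y j = if i = e' then M.det else 0 := by
    intro i
    have := congrFun (congrFun (Matrix.mul_adjugate M) i) e'
    rw [Matrix.mul_apply] at this
    simp only [hy, this, Matrix.smul_apply, Matrix.one_apply, smul_eq_mul, mul_ite, mul_one, mul_zero]
  have hye : y e' = weight b P K B := by
    simp only [hy]
    rw [Matrix.adjugate_apply, hM, det_updateRow_single_insert _ K he, weight]
  -- The column `y` solves `M y = (det M) δ_e`. Splitting `x` into `P x` and `x - P x` reads off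
  -- these equations row by row; the tails cancel because `x` lies in the span over `insert e K`.
  set x : V := ∑ j, y j • b j with hx
  have hxi : ∀ i : ↥(insert e K), ⟪b i, x⟫_ℂ = y i := fun i =>
    (hb.comp _ Subtype.val_injective).inner_right_fintype y i
  have hPx : ∀ i : E, ⟪b i, P x⟫_ℂ = ∑ j : ↥(insert e K), ⟪b i, P (b j)⟫_ℂ * y j := by
    intro i
    rw [hx, map_sum, inner_sum]
    exact Finset.sum_congr rfl fun j _ => by rw [map_smul, inner_smul_right, mul_comm]
  have hwx : ∀ i : E, ⟪b i, x - P x⟫_ℂ = ∑ j : ↥(insert e K), ⟪b i, b j - P (b j)⟫_ℂ * y j := by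
    intro i
    rw [inner_sub_right, hPx, hx, inner_sum, ← Finset.sum_sub_distrib]
    exact Finset.sum_congr rfl fun j _ => by rw [inner_smul_right, inner_sub_right]; ring
  have hw : ⟪b e, x - P x⟫_ℂ = weight b P (insert e K) B := by
    have := hMy e'
    rw [if_pos rfl] at this
    rw [hwx, weight, ← this]
    simp [hM, mixedMatrix, he', heB]
  have hne : ∀ i (hi : i ∈ K), (⟨i, Finset.mem_insert_of_mem hi⟩ : ↥(insert e K)) ≠ e' := by
    intro i hi h
    have := congrArg Subtype.val h
    simp only [he'] at this
    exact he (this ▸ hi)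
  refine ⟨P x, x - P x, hP.idem x, by rw [map_sub, hP.idem, sub_self], ?_, ?_, hw, ?_, ?_⟩
  · intro i hi hiB
    have := hMy ⟨i, Finset.mem_insert_of_mem hi⟩
    rw [if_neg (hne i hi)] at this
    rw [hPx, ← this]
    simp [hM, mixedMatrix, hiB]
  · intro i hi hiB
    have := hMy ⟨i, Finset.mem_insert_of_mem hi⟩
    rw [if_neg (hne i hi)] at this
    rw [hwx, ← this]
    simp [hM, mixedMatrix, hiB]
  · rw [← hw, ← hye, ← hxi, inner_sub_right]
    simp [he']
  · have hxs : partialSum b (insert e K) x = x := by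
      rw [partialSum, ← Finset.sum_coe_sort]
      exact Finset.sum_congr rfl fun i _ => by rw [hxi]
    have : partialSum b (insert e K) (x - P x) =
        partialSum b (insert e K) x - partialSum b (insert e K) (P x) := by
      simp [partialSum, sub_smul, Finset.sum_sub_distrib]
    rw [this, hxs]
    abel

/-- Any `h` in the range of `P` is orthogonal to the adjugate vector `w`. In the expansion of `⟪h,
w⟫` each term from `K` has a vanishing factor, leaving only `e` and the tails. Taking `h = u`
identifies `t` as `‖tail of u‖²`; general `h` uses Cauchy–Schwarz. -/
theorem conj_weight_sub_mul {b : E → V} (hb : Orthonormal ℂ b) {P : V →L[ℂ] V}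
    (hP : IsOrthProj P) {K : Finset E} {e : E} (he : e ∉ K) {B : Set E} (heB : e ∉ B) :
    ∃ t : ℝ, 0 ≤ t ∧ (starRingEnd ℂ) (weight b P K B - weight b P (insert e K) B) *
      weight b P (insert e K) B = (t : ℂ) ∧
      ∀ h : V, P h = h → (∀ i ∈ K, i ∈ B → ⟪b i, h⟫_ℂ = 0) →
        ‖⟪b e, h⟫_ℂ‖ ^ 2 * ‖weight b P (insert e K) B‖ ^ 2 ≤
          ‖h - partialSum b (insert e K) h‖ ^ 2 * t := by
  obtain ⟨u, w, hu, hw, huB, hwB, hwe, hue, huw⟩ := exists_adjugate_vectors hb hP he heB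
  have key : ∀ h : V, P h = h → (∀ i ∈ K, i ∈ B → ⟪b i, h⟫_ℂ = 0) →
      ⟪h, b e⟫_ℂ * weight b P (insert e K) B =
        ⟪h - partialSum b (insert e K) h, u - partialSum b (insert e K) u⟫_ℂ := by
    intro h hh hB
    have h0 : ⟪h, w⟫_ℂ = 0 := by rw [← hh, hP.symm, hw, inner_zero_right]
    rw [inner_eq_sum_add hb (insert e K), Finset.sum_insert he, hwe, huw, inner_neg_right,
      Finset.sum_eq_zero, add_zero] at h0
    · exact sub_eq_zero.1 (by rw [sub_eq_add_neg]; exact h0)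
    · intro i hi
      by_cases hiB : i ∈ B
      · rw [← inner_conj_symm, hB i hi hiB]; simp
      · rw [hwB i hi hiB, mul_zero]
  refine ⟨‖u - partialSum b (insert e K) u‖ ^ 2, by positivity, ?_, ?_⟩
  · have := key u hu huB
    rw [← hue, inner_conj_symm, this, inner_self_eq_norm_sq_to_K]
    simp
  · intro h hh hB
    have h1 := congrArg norm (key h hh hB)
    rw [norm_mul, ← inner_conj_symm, RCLike.norm_conj] at h1
    rw [← mul_pow, ← mul_pow, h1]
    gcongr
    exact norm_inner_le_norm _ _

theorem weight_nonneg_real {b : E → V} (hb : Orthonormal ℂ b) {P : V →L[ℂ] V}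
    (hP : IsOrthProj P) (K : Finset E) (B : Set E) :
    ∃ r : ℝ, 0 ≤ r ∧ weight b P K B = (r : ℂ) := by
  induction K using Finset.induction_on generalizing P B with
  | empty => exact ⟨1, zero_le_one, by rw [weight_empty]; simp⟩
  | insert e K he ih =>
    -- Exchanging `P` with `1 - P` complements the configuration and keeps the weight.
    wlog heB : e ∉ B generalizing P B
    · rw [← weight_compl]
      exact this hP.one_sub Bᶜ (fun h => heB h)
    obtain ⟨y, hy, hyw⟩ := ih hP B
    obtain ⟨t, ht, htw, -⟩ := conj_weight_sub_mul hb hP he heB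
    set d := weight b P (insert e K) B
    rw [hyw, map_sub, Complex.conj_ofReal, sub_mul, ← Complex.normSq_eq_conj_mul_self,
      sub_eq_iff_eq_add] at htw
    -- At this point `y d = t + |d|²`, which forces `d` to be real and nonnegative, or `0` when `y =
    -- 0`.
    rcases hy.eq_or_lt with rfl | hy'
    · refine ⟨0, le_rfl, ?_⟩
      have : t + Complex.normSq d = 0 := by
        have := htw.symm
        rw [Complex.ofReal_zero, zero_mul] at this
        exact_mod_cast this
      have h0 : Complex.normSq d = 0 := le_antisymm (by linarith) (Complex.normSq_nonneg d)
      simpa using h0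
    · refine ⟨(t + Complex.normSq d) / y, by have := Complex.normSq_nonneg d; positivity, ?_⟩
      push_cast
      rw [← htw, mul_div_cancel_left₀]
      exact_mod_cast hy'.ne'

/-- The weight as a real number. -/
def realWeight (b : E → V) (P : V →L[ℂ] V) (K : Finset E) (B : Set E) : ℝ := (weight b P K B).re

theorem realWeight_nonneg {b : E → V} (hb : Orthonormal ℂ b) {P : V →L[ℂ] V}
    (hP : IsOrthProj P) (K : Finset E) (B : Set E) : 0 ≤ realWeight b P K B := by
  obtain ⟨r, hr, h⟩ := weight_nonneg_real hb hP K B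
  simpa [realWeight, h] using hr

theorem coe_realWeight {b : E → V} (hb : Orthonormal ℂ b) {P : V →L[ℂ] V}
    (hP : IsOrthProj P) (K : Finset E) (B : Set E) :
    (realWeight b P K B : ℂ) = weight b P K B := by
  obtain ⟨r, hr, h⟩ := weight_nonneg_real hb hP K B
  simp [realWeight, h]

theorem realWeight_insert_add {b : E → V} (hb : Orthonormal ℂ b) (P : V →L[ℂ] V) {K : Finset E}
    {e : E} (he : e ∉ K) (B : Set E) :
    realWeight b P (insert e K) (insert e B) + realWeight b P (insert e K) (B \ {e}) =
      realWeight b P K B := by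
  rw [realWeight, realWeight, realWeight, ← weight_insert_add hb P he B, Complex.add_re]

theorem realWeight_bound {b : E → V} (hb : Orthonormal ℂ b) {P : V →L[ℂ] V}
    (hP : IsOrthProj P) {K : Finset E} {e : E} (he : e ∉ K) {B : Set E} (heB : e ∉ B) {h : V}
    (hh : P h = h) (hB : ∀ i ∈ K, i ∈ B → ⟪b i, h⟫_ℂ = 0) :
    ‖⟪b e, h⟫_ℂ‖ ^ 2 * realWeight b P (insert e K) B ≤
      ‖h - partialSum b (insert e K) h‖ ^ 2 *
        (realWeight b P K B - realWeight b P (insert e K) B) := by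
  obtain ⟨t, ht, htw, H⟩ := conj_weight_sub_mul hb hP he heB
  have H := H h hh hB
  have hy := realWeight_nonneg hb hP K B
  have hd := realWeight_nonneg hb hP (insert e K) B
  rw [← coe_realWeight hb hP, ← coe_realWeight hb hP] at htw
  rw [← coe_realWeight hb hP, Complex.norm_real, Real.norm_eq_abs, sq_abs] at H
  set y := realWeight b P K B
  set d := realWeight b P (insert e K) B
  rw [← Complex.ofReal_sub, Complex.conj_ofReal] at htw
  have htw : (y - d) * d = t := by exact_mod_cast htw
  rcases hd.eq_or_lt with h0 | h0
  · rw [← h0]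
    simp only [mul_zero, sub_zero]
    positivity
  · rw [← htw] at H
    refine le_of_mul_le_mul_right ?_ h0
    linarith

theorem realWeight_insert_le {b : E → V} (hb : Orthonormal ℂ b) {P : V →L[ℂ] V}
    (hP : IsOrthProj P) {K : Finset E} {e : E} (he : e ∉ K) (B : Set E) :
    realWeight b P (insert e K) (insert e B) ≤ realWeight b P K B := by
  linarith [realWeight_insert_add hb P he B, realWeight_nonneg hb hP (insert e K) (B \ {e})]

/-- Hadamard's inequality for the kernel of a projection with constant diagonal. -/
theorem realWeight_self_le_pow {b : E → V} (hb : Orthonormal ℂ b) {P : V →L[ℂ] V}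
    (hP : IsOrthProj P) {p : ℝ} (hp0 : 0 ≤ p) (hp1 : p ≤ 1) (hp : ∀ e, ⟪b e, P (b e)⟫_ℂ = p)
    (K : Finset E) : realWeight b P K K ≤ p ^ K.card := by
  induction K using Finset.induction_on with
  | empty => simp [realWeight, weight_empty]
  | insert e K he ih =>
    rw [Finset.card_insert_of_notMem he, pow_succ, mul_comm, Finset.coe_insert]
    refine le_trans ?_ (mul_le_mul_of_nonneg_left ih hp0)
    -- The main argument cancels a factor `1 - p`.
    rcases hp1.eq_or_lt with rfl | hp1
    · rw [one_mul]
      exact realWeight_insert_le hb hP he _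
    have hc : ∀ (L : Finset E) (B : Set E), realWeight b (1 - P) L Bᶜ = realWeight b P L B :=
      fun L B => by rw [realWeight, weight_compl, realWeight]
    have heq : realWeight b P K (insert e (K : Set E)) = realWeight b P K K := by
      rw [realWeight, weight_congr (B' := K) b P (fun i hi => by simp [hi]), realWeight]
    have hh : (1 - P) (b e - P (b e)) = b e - P (b e) := by simp [hP.idem]
    have hhe : ⟪b e, b e - P (b e)⟫_ℂ = ((1 - p : ℝ) : ℂ) := by
      rw [inner_sub_right, hp, inner_self_eq_norm_sq_to_K, hb.1]
      simp
    have hnorm : ‖b e - P (b e)‖ ^ 2 = 1 - p := by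
      have : ⟪b e - P (b e), b e - P (b e)⟫_ℂ = ((1 - p : ℝ) : ℂ) := by
        rw [← hhe, inner_sub_left, hP.symm, map_sub, hP.idem, sub_self, inner_zero_right, sub_zero]
      rw [inner_self_eq_norm_sq_to_K, ← RCLike.ofReal_pow] at this
      exact Complex.ofReal_injective this
    -- For `1 - P` the relevant configuration is the complement, which misses `K`, so the
    -- orthogonality conditions are vacuous.
    have hB := realWeight_bound hb hP.one_sub he (B := (insert e (K : Set E))ᶜ) (by simp) hh
      (fun i hi hi' => by simp [hi] at hi')
    rw [hc, hc, heq, hhe, Complex.norm_real, Real.norm_eq_abs, sq_abs] at hB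
    have htail : ‖(b e - P (b e)) - partialSum b (insert e K) (b e - P (b e))‖ ^ 2 ≤
        (1 - p) - (1 - p) ^ 2 := by
      have h1 := norm_sub_partialSum_sq hb (insert e K) (b e - P (b e))
      have h1 : ‖(b e - P (b e)) - partialSum b (insert e K) (b e - P (b e))‖ ^ 2 =
        ‖b e - P (b e)‖ ^ 2 - ∑ i ∈ insert e K, ‖⟪b i, b e - P (b e)⟫_ℂ‖ ^ 2 := by
        exact_mod_cast h1
      rw [h1, hnorm, Finset.sum_insert he, hhe, Complex.norm_real, Real.norm_eq_abs, sq_abs]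
      have : 0 ≤ ∑ i ∈ K, ‖⟪b i, b e - P (b e)⟫_ℂ‖ ^ 2 := Finset.sum_nonneg fun i _ => by positivity
      linarith
    have hle := realWeight_insert_le hb hP he (K : Set E)
    set d := realWeight b P (insert e K) (insert e (K : Set E))
    set y := realWeight b P K K
    have h2 : (1 - p) * ((1 - p) * d) ≤ (1 - p) * (p * (y - d)) := by
      have := mul_le_mul_of_nonneg_right htail (sub_nonneg.2 hle)
      nlinarith
    have h3 := le_of_mul_le_mul_left h2 (by linarith)
    linarith

-- The consistency relations: the indices of `C` are summed out one at a time.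
open scoped Classical in
theorem sum_realWeight {b : E → V} (hb : Orthonormal ℂ b) (P : V →L[ℂ] V) (F C : Finset E)
    (hFC : Disjoint F C) :
    ∑ T ∈ C.powerset, realWeight b P (F ∪ C) (F ∪ T : Finset E) = realWeight b P F F := by
  induction C using Finset.induction_on with
  | empty => simp
  | insert e C he ih =>
    have heF : e ∉ F := fun h => Finset.disjoint_left.1 hFC h (Finset.mem_insert_self _ _)
    rw [Finset.sum_powerset_insert he, ← Finset.sum_add_distrib,
      ← ih (hFC.mono_right (Finset.subset_insert _ _))]
    refine Finset.sum_congr rfl fun T hT => ?_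
    have heT : e ∉ T := fun h => he (Finset.mem_powerset.1 hT h)
    have heFT : ((F ∪ T : Finset E) : Set E) \ {e} = (F ∪ T : Finset E) := by
      simp [heF, heT]
    have := realWeight_insert_add hb P (K := F ∪ C) (e := e) (by simp [heF, he]) (F ∪ T : Finset E)
    rw [heFT] at this
    rw [← this, Finset.union_insert, Finset.union_insert, Finset.coe_insert, add_comm]

end Weights

/-! ### Construction and uniqueness of the measure. -/

section Existence

variable {E V : Type*} [NormedAddCommGroup V] [InnerProductSpace ℂ V]

theorem measurableSet_subset_mem (F : Finset E) : MeasurableSet {S : Set E | (F : Set E) ⊆ S} := by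
  have : {S : Set E | (F : Set E) ⊆ S} = ⋂ i ∈ F, {S : Set E | i ∈ S} := by
    ext S
    simp [Set.subset_def]
  rw [this]
  exact Finset.measurableSet_biInter _ fun i _ => measurableSet_mem i

theorem generateFrom_subset_mem : (Set.instMeasurableSpace : MeasurableSpace (Set E)) =
    MeasurableSpace.generateFrom {s | ∃ F : Finset E, s = {S : Set E | (F : Set E) ⊆ S}} := by
  classical
  apply le_antisymm
  · have : @Measurable (Set E) (Set E) (MeasurableSpace.generateFrom
        {s | ∃ F : Finset E, s = {S : Set E | (F : Set E) ⊆ S}}) _ id := by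
      refine (@measurable_set_iff _ _ (_) id).2 fun a => ?_
      refine (@measurableSet_setOfPred _ (_) _).1 (MeasurableSpace.measurableSet_generateFrom ⟨{a}, ?_⟩)
      simp
    intro s hs
    exact this hs
  · refine MeasurableSpace.generateFrom_le ?_
    rintro s ⟨F, rfl⟩
    exact measurableSet_subset_mem F

/-- A probability measure on `2^E` is determined by its inclusion probabilities. -/
theorem measure_ext_of_subset_mem [DecidableEq E] {μ ν : Measure (Set E)} [IsProbabilityMeasure μ]
    [IsProbabilityMeasure ν] (h : ∀ F : Finset E, μ.real {S : Set E | (F : Set E) ⊆ S} =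
      ν.real {S : Set E | (F : Set E) ⊆ S}) : μ = ν := by
  refine ext_of_generate_finite _ generateFrom_subset_mem ?_ ?_ (by simp)
  · rintro _ ⟨F, rfl⟩ _ ⟨G, rfl⟩ -
    refine ⟨F ∪ G, ?_⟩
    ext S
    simp
  · rintro _ ⟨F, rfl⟩
    exact (measureReal_eq_measureReal_iff).1 (h F)

/-- The finite marginals, extended by `false` off `K`, are probability measures on a compact cube. A
limit along an ultrafilter finer than `atTop` exists, and clopen cylinders have no boundary, so
their masses survive the limit. -/
theorem exists_measure_realWeight [DecidableEq E] [Countable E] {b : E → V} (hb : Orthonormal ℂ b) {P : V →L[ℂ] V}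
    (hP : IsOrthProj P) : ∃ μ : Measure (Set E), IsProbabilityMeasure μ ∧
      ∀ F : Finset E, μ.real {S : Set E | (F : Set E) ⊆ S} = realWeight b P F F := by
  let c : Finset E → (E → Bool) := fun B i => decide (i ∈ B)
  let U : Finset E → Set (E → Bool) := fun F => {x | ∀ i ∈ F, x i = true}
  have hUclopen : ∀ F, IsClopen (U F) := fun F => by
    have : U F = ⋂ i ∈ F, (fun x : E → Bool => x i) ⁻¹' {true} := by
      ext x; simp [U]
    rw [this]
    exact isClopen_biInter_finset fun i _ => (isClopen_discrete _).preimage (continuous_apply i)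
  let m : Finset E → Measure (E → Bool) := fun K =>
    ∑ B ∈ K.powerset, ENNReal.ofReal (realWeight b P K B) • Measure.dirac (c B)
  have hm : ∀ F K : Finset E, F ⊆ K → m K (U F) = ENNReal.ofReal (realWeight b P F F) := by
    intro F K hFK
    have hc : ∀ B : Finset E, c B ∈ U F ↔ F ⊆ B := fun B => by simp [c, U, Finset.subset_iff]
    have h1 : m K (U F) = ∑ B ∈ K.powerset,
        if F ⊆ B then ENNReal.ofReal (realWeight b P K B) else 0 := by
      simp only [m, Measure.coe_finsetSum, Finset.sum_apply, Measure.smul_apply, smul_eq_mul]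
      refine Finset.sum_congr rfl fun B _ => ?_
      rw [Measure.dirac_apply' _ (hUclopen F).isOpen.measurableSet, Set.indicator_apply]
      simp [hc]
    rw [h1, ← Finset.sum_filter, ← ENNReal.ofReal_sum_of_nonneg
      (f := fun B : Finset E => realWeight b P K B) fun B _ => realWeight_nonneg hb hP K B]
    congr 1
    rw [← sum_realWeight hb P F (K \ F) Finset.disjoint_sdiff, Finset.union_sdiff_of_subset hFK]
    symm
    refine Finset.sum_bij (fun T _ => F ∪ T) ?_ ?_ ?_ ?_
    · intro T hT
      rw [Finset.mem_powerset] at hT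
      rw [Finset.mem_filter, Finset.mem_powerset]
      exact ⟨Finset.union_subset hFK (hT.trans Finset.sdiff_subset), Finset.subset_union_left⟩
    · intro T hT T' hT' h
      rw [Finset.mem_powerset] at hT hT'
      have hd : Disjoint F T := Finset.disjoint_sdiff.mono_right hT
      have hd' : Disjoint F T' := Finset.disjoint_sdiff.mono_right hT'
      rw [← Finset.union_sdiff_cancel_left hd, ← Finset.union_sdiff_cancel_left hd', h]
    · intro B hB
      rw [Finset.mem_filter, Finset.mem_powerset] at hB
      exact ⟨B \ F, Finset.mem_powerset.2 (Finset.sdiff_subset_sdiff hB.1 le_rfl),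
        Finset.union_sdiff_of_subset hB.2⟩
    · intro T _
      rfl
  have hprob : ∀ K, IsProbabilityMeasure (m K) := fun K => ⟨by
    have : U ∅ = Set.univ := by simp [U]
    rw [← this, hm ∅ K (Finset.empty_subset K)]
    simp [realWeight, weight_empty]⟩
  let M : Finset E → ProbabilityMeasure (E → Bool) := fun K => ⟨m K, hprob K⟩
  let W : Ultrafilter (Finset E) := Ultrafilter.of atTop
  obtain ⟨ν, -, hν⟩ := isCompact_univ.ultrafilter_le_nhds (W.map M) (by simp)
  have hν' : Tendsto M W (𝓝 ν) := hν
  have hνU : ∀ F, (ν : Measure (E → Bool)) (U F) = ENNReal.ofReal (realWeight b P F F) := by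
    intro F
    have h1 := ProbabilityMeasure.tendsto_measure_of_null_frontier_of_tendsto' hν' (E := U F)
      (by rw [(hUclopen F).frontier_eq]; simp)
    have h2 : ∀ᶠ K in (W : Filter (Finset E)), (M K : Measure (E → Bool)) (U F) =
        ENNReal.ofReal (realWeight b P F F) :=
      (Ultrafilter.of_le atTop) ((eventually_ge_atTop F).mono fun K hK => hm F K hK)
    exact tendsto_nhds_unique h1 (tendsto_const_nhds.congr' (h2.mono fun K hK => hK.symm))
  let g : (E → Bool) → Set E := fun x => {i | x i = true}
  have hg : Measurable g := measurable_set_iff.2 fun a =>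
    measurableSet_setOfPred.1 (measurableSet_eq_fun (measurable_pi_apply a) measurable_const)
  refine ⟨(ν : Measure (E → Bool)).map g, Measure.isProbabilityMeasure_map hg.aemeasurable,
    fun F => ?_⟩
  rw [measureReal_def, Measure.map_apply hg (measurableSet_subset_mem F)]
  have : g ⁻¹' {S : Set E | (F : Set E) ⊆ S} = U F := by
    ext x
    simp [g, U, Set.subset_def]
  rw [this, hνU, ENNReal.toReal_ofReal (realWeight_nonneg hb hP F F)]

end Existence

/-! ### All cylinder probabilities from the inclusion probabilities. -/

section Cylinders

variable {E V : Type*} [NormedAddCommGroup V] [InnerProductSpace ℂ V]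

/-- The set of configurations that agree with `B` on `K`. -/
def agreeOn (K : Finset E) (B : Set E) : Set (Set E) := {S | ∀ i ∈ K, (i ∈ S ↔ i ∈ B)}

theorem measurableSet_agreeOn (K : Finset E) (B : Set E) : MeasurableSet (agreeOn K B) := by
  have : agreeOn K B = ⋂ i ∈ K, {S : Set E | i ∈ S ↔ i ∈ B} := by
    ext S
    simp [agreeOn]
  rw [this]
  refine Finset.measurableSet_biInter _ fun i _ => ?_
  by_cases hi : i ∈ B
  · simpa [hi] using measurableSet_mem i
  · simp only [hi, iff_false]
    exact (measurableSet_mem i).compl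

/-- Induction on the set `C` of excluded indices: measure and weight satisfy the same recursion when
an index is excluded. -/
theorem measureReal_agreeOn_union [DecidableEq E] {b : E → V} (hb : Orthonormal ℂ b) {P : V →L[ℂ] V}
    {μ : Measure (Set E)} [IsProbabilityMeasure μ]
    (hμ : ∀ F : Finset E, μ.real {S : Set E | (F : Set E) ⊆ S} = realWeight b P F F)
    (C F : Finset E) (hFC : Disjoint F C) :
    μ.real (agreeOn (F ∪ C) F) = realWeight b P (F ∪ C) F := by
  induction C using Finset.induction_on generalizing F with
  | empty =>
    rw [Finset.union_empty, ← hμ]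
    congr 1
    ext S
    simp +contextual [agreeOn, Set.subset_def]
  | insert e C he ih =>
    have heF : e ∉ F := fun h => Finset.disjoint_left.1 hFC h (Finset.mem_insert_self _ _)
    have hFC' : Disjoint F C := hFC.mono_right (Finset.subset_insert _ _)
    have h1 := ih F hFC'
    have h2 := ih (insert e F) (Finset.disjoint_insert_left.2 ⟨he, hFC'⟩)
    have h3 := realWeight_insert_add hb P (K := F ∪ C) (e := e) (by simp [heF, he]) F
    have h4 : (F : Set E) \ {e} = F := by simp [heF]
    rw [Finset.insert_union, Finset.coe_insert] at h2
    rw [h4] at h3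
    have h5 : agreeOn (F ∪ C) (F : Set E) =
        agreeOn (insert e (F ∪ C)) (insert e (F : Set E)) ∪ agreeOn (insert e (F ∪ C)) (F : Set E) := by
      ext S
      have hne : ∀ i ∈ F ∪ C, i ≠ e := by
        rintro i hi rfl
        simp [heF, he] at hi
      simp only [agreeOn, Set.mem_ofPred_eq, Set.mem_union, Finset.forall_mem_insert]
      have h6 : (∀ i ∈ F ∪ C, (i ∈ S ↔ i ∈ insert e (F : Set E))) ↔
          ∀ i ∈ F ∪ C, (i ∈ S ↔ i ∈ (F : Set E)) :=
        forall₂_congr fun i hi => by simp [hne i hi]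
      rw [h6]
      simp only [Set.mem_insert_iff, true_or, iff_true, Finset.mem_coe, heF, iff_false]
      by_cases heS : e ∈ S <;> simp [heS]
    have h6 : Disjoint (agreeOn (insert e (F ∪ C)) (insert e (F : Set E)))
        (agreeOn (insert e (F ∪ C)) (F : Set E)) := by
      rw [Set.disjoint_left]
      intro S hS hS'
      have := hS e (Finset.mem_insert_self _ _)
      have := hS' e (Finset.mem_insert_self _ _)
      simp_all
    rw [Finset.union_insert]
    rw [h5, measureReal_union h6 (measurableSet_agreeOn _ _), h2] at h1
    linarith

theorem measureReal_agreeOn [DecidableEq E] {b : E → V} (hb : Orthonormal ℂ b) {P : V →L[ℂ] V}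
    {μ : Measure (Set E)} [IsProbabilityMeasure μ]
    (hμ : ∀ F : Finset E, μ.real {S : Set E | (F : Set E) ⊆ S} = realWeight b P F F)
    (K : Finset E) (B : Set E) : μ.real (agreeOn K B) = realWeight b P K B := by
  classical
  have h := measureReal_agreeOn_union hb hμ (K.filter (· ∉ B)) (K.filter (· ∈ B))
    (Finset.disjoint_filter_filter_not _ _ _)
  rw [Finset.filter_union_filter_not_eq] at h
  have h1 : agreeOn K ((K.filter (· ∈ B) : Finset E) : Set E) = agreeOn K B := by
    ext S
    exact forall₂_congr fun i hi => by simp [hi]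
  rw [← h1, h, realWeight, weight_congr b P (B' := B) fun i hi => by simp [hi], realWeight]

/-- The complementary configuration has the inclusion probabilities of the complementary
projection. -/
theorem measureReal_disjoint [DecidableEq E] {b : E → V} (hb : Orthonormal ℂ b) {P : V →L[ℂ] V}
    {μ : Measure (Set E)} [IsProbabilityMeasure μ]
    (hμ : ∀ F : Finset E, μ.real {S : Set E | (F : Set E) ⊆ S} = realWeight b P F F)
    (F : Finset E) : μ.real {S : Set E | (F : Set E) ⊆ Sᶜ} = realWeight b (1 - P) F F := by
  have h : {S : Set E | (F : Set E) ⊆ Sᶜ} = agreeOn F (F : Set E)ᶜ := by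
    ext S
    simp +contextual [agreeOn, Set.subset_def]
  rw [h, measureReal_agreeOn hb hμ, realWeight, ← weight_compl, compl_compl, realWeight]

end Cylinders

/-! ### Almost sure completeness. -/

section Completeness

variable {V : Type*} [NormedAddCommGroup V] [InnerProductSpace ℂ V]

/-- The configurations for which some `h` in the range of `P`, vanishing on the configuration
within `J`, has little mass outside `J` compared with its value at `e`. -/
def concentratedAt {E : Type*} (b : E → V) (P : V →L[ℂ] V) (J : Finset E) (e : E) (ε : ℝ) :
    Set (Set E) :=
  {S | e ∉ S ∧ ∃ h : V, P h = h ∧ (∀ i ∈ J, i ∈ S → ⟪b i, h⟫_ℂ = 0) ∧ ⟪b e, h⟫_ℂ ≠ 0 ∧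
    ‖h - partialSum b J h‖ ^ 2 ≤ ε * ‖⟪b e, h⟫_ℂ‖ ^ 2}

/-- The event depends only on `S` within `insert e K`. On each of its cylinders `realWeight_bound`
says that, given `S` on `K`, missing `e` has conditional probability at most `ε`; summing over the
cylinders keeps the bound. -/
theorem measureReal_concentratedAt_le {E : Type*} [DecidableEq E] {b : E → V}
    (hb : Orthonormal ℂ b) {P : V →L[ℂ] V} (hP : IsOrthProj P)
    {μ : Measure (Set E)} [IsProbabilityMeasure μ]
    (hμ : ∀ F : Finset E, μ.real {S : Set E | (F : Set E) ⊆ S} = realWeight b P F F)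
    (K : Finset E) {e : E} (he : e ∉ K) {ε : ℝ} (hε : 0 ≤ ε) :
    μ.real (concentratedAt b P (insert e K) e ε) ≤ ε := by
  classical
  set G := concentratedAt b P (insert e K) e ε with hG
  have hsub : G ⊆ ⋃ B ∈ K.powerset.filter (fun B : Finset E => (B : Set E) ∈ G),
      agreeOn (insert e K) (B : Set E) := by
    intro S hS
    have hmem : ∀ i ∈ insert e K, (i ∈ S ↔ i ∈ ((K.filter (· ∈ S) : Finset E) : Set E)) := by
      intro i hi
      rw [Finset.mem_insert] at hi
      rcases hi with rfl | hi
      · simp [he, hS.1]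
      · simp [hi]
    simp only [Set.mem_iUnion]
    refine ⟨K.filter (· ∈ S), Finset.mem_filter.2
      ⟨Finset.mem_powerset.2 (Finset.filter_subset _ _), ?_⟩, hmem⟩
    obtain ⟨heS, h, h1, h2, h3, h4⟩ := hS
    exact ⟨by simp [he], h, h1, fun i hi hi' => h2 i hi ((hmem i hi).2 hi'), h3, h4⟩
  have hle : ∀ B ∈ K.powerset.filter (fun B : Finset E => (B : Set E) ∈ G),
      realWeight b P (insert e K) B ≤ ε * realWeight b P K B := by
    intro B hB
    rw [Finset.mem_filter] at hB
    obtain ⟨heB, h, h1, h2, h3, h4⟩ := hB.2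
    have key := realWeight_bound hb hP he heB h1
      fun i hi hiB => h2 i (Finset.mem_insert_of_mem hi) hiB
    have hpos : 0 < ‖⟪b e, h⟫_ℂ‖ ^ 2 := by positivity
    have hd := realWeight_nonneg hb hP (insert e K) B
    have hyd : 0 ≤ realWeight b P K B - realWeight b P (insert e K) B := by
      have h5 := realWeight_insert_add hb P he (B : Set E)
      have h6 : (B : Set E) \ {e} = B := by simpa using heB
      have h7 := realWeight_nonneg hb hP (insert e K) (insert e (B : Set E))
      rw [h6] at h5
      linarith
    have h5 := key.trans (mul_le_mul_of_nonneg_right h4 hyd)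
    have h6 : realWeight b P (insert e K) B ≤
        ε * (realWeight b P K B - realWeight b P (insert e K) B) :=
      le_of_mul_le_mul_left (by linarith) hpos
    nlinarith
  have hsum := sum_realWeight hb P ∅ K (Finset.disjoint_empty_left K)
  simp only [Finset.empty_union, Finset.coe_empty] at hsum
  calc μ.real G ≤ μ.real (⋃ B ∈ K.powerset.filter (fun B : Finset E => (B : Set E) ∈ G),
        agreeOn (insert e K) (B : Set E)) := measureReal_mono hsub (measure_ne_top _ _)
    _ ≤ ∑ B ∈ K.powerset.filter (fun B : Finset E => (B : Set E) ∈ G),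
        μ.real (agreeOn (insert e K) (B : Set E)) := measureReal_biUnion_finset_le _ _
    _ ≤ ∑ B ∈ K.powerset.filter (fun B : Finset E => (B : Set E) ∈ G),
        ε * realWeight b P K B :=
      Finset.sum_le_sum fun B hB => by rw [measureReal_agreeOn hb hμ]; exact hle B hB
    _ ≤ ∑ B ∈ K.powerset, ε * realWeight b P K B :=
      Finset.sum_le_sum_of_subset_of_nonneg (Finset.filter_subset _ _)
        fun B _ _ => mul_nonneg hε (realWeight_nonneg hb hP K B)
    _ = ε := by
      rw [← Finset.mul_sum, hsum]
      simp [realWeight, weight_empty]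

/-- Almost surely, a vector in the range of `P` that is orthogonal to the basis vectors of the
determinantal process vanishes. -/
theorem ae_eq_zero_of_inner_eq_zero {E : Type*} [DecidableEq E] [Countable E]
    (b : HilbertBasis E ℂ V) {P : V →L[ℂ] V} (hP : IsOrthProj P)
    {μ : Measure (Set E)} [IsProbabilityMeasure μ]
    (hμ : ∀ F : Finset E, μ.real {S : Set E | (F : Set E) ⊆ S} = realWeight b P F F) :
    ∀ᵐ S ∂μ, ∀ h : V, P h = h → (∀ i ∈ S, ⟪b i, h⟫_ℂ = 0) → h = 0 := by
  have hb := b.orthonormal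
  have main : ∀ e : E, ∀ᵐ S ∂μ, ∀ h : V, P h = h → (∀ i ∈ S, ⟪b i, h⟫_ℂ = 0) → ⟪b e, h⟫_ℂ = 0 := by
    intro e
    obtain ⟨f, hf⟩ := exists_seq_tendsto (atTop : Filter (Finset E))
    let J : ℕ → Finset E := fun n => insert e ((f n).erase e)
    have hJ : Tendsto J atTop atTop := by
      refine tendsto_atTop_mono (fun n => ?_) hf
      intro i hi
      by_cases h : i = e <;> simp [J, h, hi]
    rw [ae_iff]
    set D := {S : Set E | ¬ ∀ h : V, P h = h → (∀ i ∈ S, ⟪b i, h⟫_ℂ = 0) → ⟪b e, h⟫_ℂ = 0} with hD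
    have hle : ∀ ε : ℝ, 0 < ε → μ D ≤ ENNReal.ofReal ε := by
      intro ε hε
      -- Basis expansions converge, so a bad `h` witnesses concentration along all large `n`. The
      -- quantifier over `h` sits inside the events, so no uncountable union arises.
      have hsub : D ⊆ ⋃ N, ⋂ n ∈ Set.Ici N, concentratedAt b P (J n) e ε := by
        intro S hS
        simp only [hD, Set.mem_ofPred_eq] at hS
        push Not at hS
        obtain ⟨h, h1, h2, h3⟩ := hS
        have hlim : Tendsto (fun n => ‖h - partialSum b (J n) h‖ ^ 2) atTop (𝓝 0) := by
          have h4 : Tendsto (fun n => partialSum b (J n) h) atTop (𝓝 h) := by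
            have := (b.hasSum_repr h).comp hJ
            refine this.congr fun n => ?_
            simp [partialSum, b.repr_apply_apply]
          have h5 := ((tendsto_const_nhds (x := h)).sub h4).norm.pow 2
          simpa using h5
        have hpos : 0 < ε * ‖⟪b e, h⟫_ℂ‖ ^ 2 := by positivity
        obtain ⟨N, hN⟩ := (hlim.eventually (gt_mem_nhds hpos)).exists_forall_of_atTop
        simp only [Set.mem_iUnion, Set.mem_iInter]
        exact ⟨N, fun n hn => ⟨fun heS => h3 (h2 e heS), h, h1, fun i _ hi => h2 i hi, h3,
          (hN n hn).le⟩⟩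
      refine (measure_mono hsub).trans ?_
      rw [Monotone.measure_iUnion]
      · refine iSup_le fun N => ?_
        refine (measure_mono (Set.biInter_subset_of_mem (Set.self_mem_Ici))).trans ?_
        rw [← ofReal_measureReal]
        exact ENNReal.ofReal_le_ofReal
          (measureReal_concentratedAt_le hb hP hμ _ (Finset.notMem_erase e _) hε.le)
      · intro N N' hNN
        exact Set.biInter_subset_biInter_left (Set.Ici_subset_Ici.2 hNN)
    refine le_antisymm (ENNReal.le_of_forall_pos_le_add fun ε hε _ => ?_) bot_le
    simpa using hle ε hε
  filter_upwards [ae_all_iff.2 main] with S hS h h1 h2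
  have : b.repr h = 0 := by
    ext i
    rw [b.repr_apply_apply, hS i h h1 h2]
    rfl
  simpa using this

end Completeness

/-! ### Large deviations from inclusion probabilities. -/

section Chernoff

variable {E Ω : Type*} [MeasurableSpace Ω]

/-- A Chernoff bound for random sets whose inclusion probabilities are at most those of independent
sampling with density `p`. -/
theorem measureReal_ncard_ge_le {μ : Measure Ω} [IsProbabilityMeasure μ] {X : Ω → Set E} {p D s : ℝ}
    (hs : 0 < s)
    (hX : ∀ F : Finset E, MeasurableSet {ω | (F : Set E) ⊆ X ω})
    (hp : ∀ F : Finset E, μ.real {ω | (F : Set E) ⊆ X ω} ≤ p ^ F.card) (I : Finset E) :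
    (1 + s) ^ (D * I.card) * μ.real {ω | D * I.card ≤ ((X ω ∩ I).ncard : ℝ)} ≤
      (1 + s * p) ^ I.card := by
  classical
  -- This is the binomial expansion of `(1 + s) ^ |X ∩ I|`, whose expectation involves only
  -- inclusion probabilities.
  let f : Ω → ℝ := fun ω => ∑ F ∈ I.powerset,
    {ω | (F : Set E) ⊆ X ω}.indicator (fun _ => s ^ F.card) ω
  have hf : ∀ ω, f ω = (1 + s) ^ (X ω ∩ I).ncard := by
    intro ω
    have h1 : (X ω ∩ I) = ((I.filter (· ∈ X ω) : Finset E) : Set E) := by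
      ext i
      simp [and_comm]
    have h2 : f ω = ∑ F ∈ (I.filter (· ∈ X ω)).powerset, s ^ F.card := by
      simp only [f, Set.indicator_apply, Set.mem_ofPred_eq]
      rw [← Finset.sum_filter]
      refine Finset.sum_congr ?_ fun _ _ => rfl
      ext F
      simp only [Finset.mem_filter, Finset.mem_powerset, Finset.subset_iff, Set.subset_def,
        Finset.mem_coe]
      grind
    rw [h1, Set.ncard_coe_finset, h2, add_comm, ← Finset.sum_pow_mul_eq_add_pow]
    simp
  have hint : ∀ F ∈ I.powerset,
      Integrable ({ω | (F : Set E) ⊆ X ω}.indicator (fun _ => s ^ F.card)) μ :=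
    fun F _ => (integrable_const _).indicator (hX F)
  have h0 : 0 ≤ᵐ[μ] f := ae_of_all _ fun ω => by
    rw [hf]
    positivity
  have h1 : ∫ ω, f ω ∂μ ≤ (1 + s * p) ^ I.card := by
    simp only [f]
    rw [integral_finsetSum _ hint, add_comm, ← Finset.sum_pow_mul_eq_add_pow]
    refine Finset.sum_le_sum fun F hF => ?_
    rw [integral_indicator_const _ (hX F), smul_eq_mul, one_pow, mul_one, mul_pow, mul_comm]
    exact mul_le_mul_of_nonneg_left (hp F) (by positivity)
  have h2 := mul_meas_ge_le_integral_of_nonneg h0 (integrable_finsetSum _ hint)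
    ((1 + s) ^ (D * I.card))
  refine le_trans (mul_le_mul_of_nonneg_left (measureReal_mono ?_) (by positivity)) (h2.trans h1)
  intro ω hω
  simp only [Set.mem_ofPred_eq] at hω ⊢
  rw [hf, ← Real.rpow_natCast]
  exact Real.rpow_le_rpow_of_exponent_le (by linarith) hω

theorem exists_exponential_bound {μ : Measure Ω} [IsProbabilityMeasure μ] {X : Ω → Set E} {p D : ℝ}
    (hp0 : 0 ≤ p) (hp1 : p ≤ 1) (hpD : p < D)
    (hX : ∀ F : Finset E, MeasurableSet {ω | (F : Set E) ⊆ X ω})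
    (hp : ∀ F : Finset E, μ.real {ω | (F : Set E) ⊆ X ω} ≤ p ^ F.card) :
    ∃ q : ℝ, 0 < q ∧ q < 1 ∧ ∀ I : Finset E,
      μ.real {ω | D * I.card ≤ ((X ω ∩ I).ncard : ℝ)} ≤ q ^ I.card := by
  -- This choice gives `p (1 + s) < D`, which with `log (1 + s) ≥ s / (1 + s)` makes the exponent
  -- negative.
  set s := (D - p) / 2 with hs
  have hs0 : 0 < s := by linarith
  have hD : 0 < D := by linarith
  refine ⟨Real.exp (s * p - D * Real.log (1 + s)), Real.exp_pos _, ?_, fun I => ?_⟩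
  · rw [Real.exp_lt_one_iff]
    have h1 := Real.one_sub_inv_le_log_of_pos (show (0 : ℝ) < 1 + s by linarith)
    have h2 : 1 - (1 + s)⁻¹ = s / (1 + s) := by field_simp; ring
    rw [h2] at h1
    have h3 : s * p < D * (s / (1 + s)) := by
      have h4 : p * (1 + s) < D := by nlinarith
      rw [← mul_div_assoc, lt_div_iff₀ (by linarith)]
      nlinarith
    have := mul_le_mul_of_nonneg_left h1 hD.le
    linarith
  · have h := measureReal_ncard_ge_le (D := D) hs0 hX hp I
    have hpos : 0 < (1 + s) ^ (D * (I.card : ℝ)) := by positivity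
    have h1 : (1 + s * p) ^ I.card ≤ Real.exp (s * p) ^ I.card := by
      refine pow_le_pow_left₀ (by positivity) ?_ _
      linarith [Real.add_one_le_exp (s * p)]
    refine le_of_mul_le_mul_left (h.trans (h1.trans (le_of_eq ?_))) hpos
    rw [Real.rpow_def_of_pos (by linarith), ← Real.exp_nat_mul, ← Real.exp_nat_mul, ← Real.exp_add]
    congr 1
    ring

end Chernoff

/-! ### The Beurling–Malliavin density by Borel–Cantelli. -/

section Density

theorem bmSet_anti {S : Set ℤ} {D D' : ℝ} (h0 : 0 ≤ D') (hle : D' ≤ D) (hD : D ∈ bmSet S) :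
    D' ∈ bmSet S := by
  obtain ⟨-, a, b, h1, h2, h3, h4⟩ := hD
  exact ⟨h0, a, b, h1, h2, fun n => le_trans (by gcongr) (h3 n), h4⟩

/-- The aspect exceeds `1` by at most `2k / |a|`, the factor `2` covering negative intervals, where
the minimum is `|a| - k`. Since `k² ≤ √|a|`, the square is at most `4 √|a| / a²`, summable over
integers `a`. -/
theorem aspect_sub_one_bound {a b : ℤ} {k : ℕ} (hb : b = a + k) (h0 : (0 : ℤ) ∉ Set.Icc a b)
    (hk : 2 * ((k : ℝ) + 1) ^ 4 ≤ |(a : ℝ)|) :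
    (aspect a b - 1) ^ 2 ≤ 4 * |(a : ℝ)| ^ (-(3 / 2) : ℝ) := by
  have hk0 : (0 : ℝ) ≤ k := Nat.cast_nonneg k
  have hk4 : (k : ℝ) ^ 4 ≤ ((k : ℝ) + 1) ^ 4 := by gcongr; linarith
  have hk1 : (k : ℝ) + 1 ≤ ((k : ℝ) + 1) ^ 4 := le_self_pow₀ (by linarith) (by norm_num)
  have hapos : 0 < |(a : ℝ)| := by linarith
  have hbR : (b : ℝ) = a + k := by rw [hb]; push_cast; ring
  have hasp : 0 ≤ aspect a b - 1 ∧ aspect a b - 1 ≤ 2 * k / |(a : ℝ)| := by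
    by_cases ha : 0 < a
    · have haR : (0 : ℝ) < a := by exact_mod_cast ha
      have : aspect a b - 1 = k / a := by
        unfold aspect
        rw [hbR, abs_of_pos haR, abs_of_pos (by linarith), max_eq_right (by linarith),
          min_eq_left (by linarith)]
        field_simp
        ring
      rw [this, abs_of_pos haR]
      exact ⟨by positivity, by gcongr; linarith⟩
    · have hb0 : b < 0 := by
        by_contra hb0
        exact h0 ⟨by omega, by omega⟩
      have hbR0 : (b : ℝ) < 0 := by exact_mod_cast hb0
      have haR : (a : ℝ) < 0 := by linarith
      rw [abs_of_neg haR] at *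
      have : aspect a b - 1 = k / (-a - k) := by
        unfold aspect
        rw [abs_of_neg haR, abs_of_neg hbR0, max_eq_left (by linarith), min_eq_right (by linarith),
          hbR]
        have h1 : -(a : ℝ) - k ≠ 0 := by linarith
        rw [neg_add', div_sub_one h1]
        congr 1
        ring
      rw [this]
      refine ⟨div_nonneg hk0 (by linarith), ?_⟩
      rw [div_le_div_iff₀ (by linarith) hapos]
      nlinarith
  have h1 : (aspect a b - 1) ^ 2 ≤ (2 * k / |(a : ℝ)|) ^ 2 := by
    gcongr
    exacts [hasp.1, hasp.2]
  refine h1.trans ?_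
  have h2 : |(a : ℝ)| ^ (-(3 / 2) : ℝ) = √|(a : ℝ)| / |(a : ℝ)| ^ 2 := by
    rw [Real.sqrt_eq_rpow, ← Real.rpow_natCast, ← Real.rpow_sub hapos]
    norm_num
  have h3 : (k : ℝ) ^ 2 ≤ √|(a : ℝ)| := Real.le_sqrt_of_sq_le (by
    have : ((k : ℝ) ^ 2) ^ 2 = (k : ℝ) ^ 4 := by ring
    have := pow_nonneg hk0 4
    linarith)
  rw [h2, div_pow, mul_pow, ← mul_div_assoc]
  gcongr
  norm_num

/-- If only finitely many intervals, among those that are not too short compared with their distance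
from the origin, have density at least `D`, then `D` exceeds the density. -/
theorem notMem_bmSet {S : Set ℤ} {D : ℝ} (h : {x : ℤ × ℕ | |(x.1 : ℝ)| ≤ 2 * ((x.2 : ℝ) + 1) ^ 4 ∧
    D * ((Finset.Icc x.1 (x.1 + x.2)).card : ℝ) ≤
      ((S ∩ (Finset.Icc x.1 (x.1 + x.2) : Finset ℤ)).ncard : ℝ)}.Finite) : D ∉ bmSet S := by
  rintro ⟨-, a, b, hab, hd, hden, hns⟩
  apply hns
  have hainj : Function.Injective a := by
    intro m n hmn
    by_contra hne
    exact Set.disjoint_left.1 (hd hne) (Set.left_mem_Icc.2 (hab m).1)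
      (by rw [hmn]; exact Set.left_mem_Icc.2 (hab n).1)
  let x : ℕ → ℤ × ℕ := fun n => (a n, (b n - a n).toNat)
  have hxinj : Function.Injective x := fun m n hmn => hainj (congrArg Prod.fst hmn)
  have hb : ∀ n, b n = a n + ((b n - a n).toNat : ℕ) := fun n => by
    have := (hab n).1
    omega
  have hfin := h.preimage hxinj.injOn
  -- Disjoint intervals have distinct left endpoints, so short intervals contribute a convergent
  -- series.
  have hsum : Summable fun n => 4 * |(a n : ℝ)| ^ (-(3 / 2) : ℝ) :=
    ((Real.summable_abs_int_rpow (by norm_num : (1 : ℝ) < 3 / 2)).comp_injective hainj).mul_left 4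
  refine hsum.of_norm_bounded_eventually ?_
  filter_upwards [hfin.compl_mem_cofinite] with n hn
  rw [Real.norm_of_nonneg (sq_nonneg _)]
  refine aspect_sub_one_bound (hb n) (hab n).2 ?_
  by_contra hlt
  apply hn
  refine ⟨(not_le.1 hlt).le, ?_⟩
  have := hden n
  simp only [x, ← hb n, Finset.coe_Icc]
  rwa [← Finset.coe_Icc, Set.ncard_coe_finset, Finset.coe_Icc] at this

theorem mem_bmSet_of_eventually {S : Set ℤ} {D : ℝ} (hD : 0 ≤ D)
    (h : ∀ᶠ n : ℕ in atTop, D * ((Finset.Icc ((4 : ℤ) ^ n) (2 * 4 ^ n)).card : ℝ) ≤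
      ((S ∩ (Finset.Icc ((4 : ℤ) ^ n) (2 * 4 ^ n) : Finset ℤ)).ncard : ℝ)) : D ∈ bmSet S := by
  obtain ⟨N, hN⟩ := h.exists_forall_of_atTop
  have h4 : ∀ n : ℕ, (0 : ℤ) < 4 ^ n := fun n => by positivity
  have key : ∀ m n : ℕ, m < n →
      Disjoint (Set.Icc ((4 : ℤ) ^ m) (2 * 4 ^ m)) (Set.Icc ((4 : ℤ) ^ n) (2 * 4 ^ n)) := by
    intro m n hmn
    rw [Set.disjoint_left]
    rintro x ⟨-, hx⟩ ⟨hx', -⟩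
    have h1 : (4 : ℤ) ^ (m + 1) ≤ 4 ^ n := pow_le_pow_right₀ (by norm_num) hmn
    rw [pow_succ] at h1
    have := h4 m
    linarith
  refine ⟨hD, fun n => 4 ^ (n + N), fun n => 2 * 4 ^ (n + N), fun n => ⟨?_, ?_⟩, ?_, fun n => ?_, ?_⟩
  · have := h4 (n + N)
    linarith
  · rintro ⟨h, -⟩
    exact absurd h (not_le.2 (h4 (n + N)))
  · intro m n hmn
    rcases lt_or_gt_of_ne hmn with h | h
    · exact key _ _ (by omega)
    · exact (key _ _ (by omega)).symm
  · have := hN (n + N) (by omega)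
    rw [← Set.ncard_coe_finset] at this
    simpa only [Finset.coe_Icc] using this
  · have : (fun n : ℕ => (aspect (4 ^ (n + N)) (2 * 4 ^ (n + N)) - 1) ^ 2) = fun _ => (1 : ℝ) := by
      funext n
      have h : (0 : ℝ) < 4 ^ (n + N) := by positivity
      have e : aspect (4 ^ (n + N)) (2 * 4 ^ (n + N)) = 2 := by
        unfold aspect
        push_cast
        rw [abs_of_pos h, abs_of_pos (by positivity), max_eq_right (by linarith),
          min_eq_left (by linarith)]
        field_simp
      rw [e]
      norm_num
    rw [this]
    simp [summable_const_iff]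

/-- Where the indicator is nonzero and `a ≠ 0`, `1 ≤ 4 (k + 1)⁸ / a²`, which dominates the double
series by a product of two convergent ones. -/
theorem summable_interval_bound {q : ℝ} (hq0 : 0 < q) (hq1 : q < 1) :
    Summable fun x : ℤ × ℕ => if |(x.1 : ℝ)| ≤ 2 * ((x.2 : ℝ) + 1) ^ 4 then q ^ (x.2 + 1) else 0 := by
  -- The extra `1` handles `a = 0`, where `0 ^ (-2)` is `0` by convention.
  have h1 : Summable fun a : ℤ => |(a : ℝ)| ^ (-2 : ℝ) + if a = 0 then 1 else 0 :=
    (Real.summable_abs_int_rpow (by norm_num)).add (summable_of_hasFiniteSupport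
      ((Set.finite_singleton (0 : ℤ)).subset fun a ha => by
        by_contra h
        simp_all))
  have h2 : Summable fun k : ℕ => 4 * ((((k + 1 : ℕ) : ℝ)) ^ 8 * q ^ (k + 1)) :=
    (((summable_nat_add_iff 1).2 (summable_pow_mul_geometric_of_norm_lt_one (R := ℝ) 8 (r := q)
      (by rwa [Real.norm_of_nonneg hq0.le])))).mul_left 4
  have h3 := h1.mul_of_nonneg h2 (fun a => by positivity) (fun k => by positivity)
  refine h3.of_nonneg_of_le (fun x => by split_ifs <;> positivity) fun x => ?_
  obtain ⟨a, k⟩ := x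
  simp only
  split_ifs with h ha ha
  · have : (1 : ℝ) ≤ ((k + 1 : ℕ) : ℝ) ^ 8 := one_le_pow₀ (by push_cast; linarith [k.cast_nonneg (α := ℝ)])
    have hz : (0 : ℝ) ≤ |(a : ℝ)| ^ (-2 : ℝ) := by positivity
    have hq : 0 < q ^ (k + 1) := by positivity
    have : q ^ (k + 1) ≤ ((k + 1 : ℕ) : ℝ) ^ 8 * q ^ (k + 1) := le_mul_of_one_le_left hq.le this
    nlinarith
  · have haR : 0 < |(a : ℝ)| := by positivity
    have : |(a : ℝ)| ^ (-2 : ℝ) = (|(a : ℝ)| ^ 2)⁻¹ := by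
      rw [Real.rpow_neg haR.le]
      norm_cast
    rw [add_zero, this, inv_mul_eq_div, le_div_iff₀ (by positivity)]
    have h5 : |(a : ℝ)| ^ 2 ≤ (2 * ((k : ℝ) + 1) ^ 4) ^ 2 := by gcongr
    have hq : 0 < q ^ (k + 1) := by positivity
    push_cast
    nlinarith [mul_le_mul_of_nonneg_left h5 hq.le]
  · positivity
  · positivity

theorem ae_finite_of_summable {μ : Measure (Set ℤ)} [IsFiniteMeasure μ] {ι : Type*} [Countable ι] {s : ι → Set (Set ℤ)} {g : ι → ℝ}
    (hg : Summable g) (hs : ∀ i, μ.real (s i) ≤ g i) : ∀ᵐ S ∂μ, {i | S ∈ s i}.Finite := by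
  refine ae_finite_setOfPred_mem (ne_top_of_le_ne_top hg.tsum_ofReal_ne_top ?_)
  refine ENNReal.tsum_le_tsum fun i => ?_
  rw [← ofReal_measureReal]
  exact ENNReal.ofReal_le_ofReal (hs i)

variable {μ : Measure (Set ℤ)} [IsProbabilityMeasure μ] {p : ℝ}

theorem ae_notMem_bmSet (hp0 : 0 ≤ p) (hp1 : p ≤ 1)
    (hp : ∀ F : Finset ℤ, μ.real {S | (F : Set ℤ) ⊆ S} ≤ p ^ F.card) {D : ℝ} (hD : p < D) :
    ∀ᵐ S ∂μ, D ∉ bmSet S := by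
  obtain ⟨q, hq0, hq1, hq⟩ := exists_exponential_bound (X := fun S : Set ℤ => S) hp0 hp1 hD
    (fun F => measurableSet_subset_mem F) hp
  have := ae_finite_of_summable (μ := μ) (s := fun x : ℤ × ℕ =>
    {S | |(x.1 : ℝ)| ≤ 2 * ((x.2 : ℝ) + 1) ^ 4 ∧ D * ((Finset.Icc x.1 (x.1 + x.2)).card : ℝ) ≤
      ((S ∩ (Finset.Icc x.1 (x.1 + x.2) : Finset ℤ)).ncard : ℝ)})
    (summable_interval_bound hq0 hq1) (fun x => by
      split_ifs with h
      · simp only [h, true_and]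
        refine (hq _).trans (le_of_eq ?_)
        congr 1
        rw [Int.card_Icc]
        omega
      · simp [h])
  filter_upwards [this] with S hS
  exact notMem_bmSet hS

/-- The upper tail bound for the complement, with `1 - D > 1 - p`, shows that almost surely all but
finitely many of the dyadic blocks `[4^n, 2·4^n]` have density at least `D`; each has aspect `2`. -/
theorem ae_mem_bmSet (hp1 : p ≤ 1)
    (hp : ∀ F : Finset ℤ, μ.real {S | (F : Set ℤ) ⊆ Sᶜ} ≤ (1 - p) ^ F.card) {D : ℝ} (hD0 : 0 ≤ D)
    (hD : D < p) : ∀ᵐ S ∂μ, D ∈ bmSet S := by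
  have hmeas : ∀ F : Finset ℤ, MeasurableSet {S : Set ℤ | (F : Set ℤ) ⊆ Sᶜ} := fun F => by
    have : {S : Set ℤ | (F : Set ℤ) ⊆ Sᶜ} = agreeOn F ∅ := by
      ext S
      simp [agreeOn, Set.subset_def]
    rw [this]
    exact measurableSet_agreeOn _ _
  obtain ⟨q, hq0, hq1, hq⟩ := exists_exponential_bound (X := fun S : Set ℤ => Sᶜ) (D := 1 - D)
    (by linarith : 0 ≤ 1 - p) (by linarith) (by linarith) hmeas hp
  have := ae_finite_of_summable (μ := μ) (s := fun n : ℕ =>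
    {S | (1 - D) * ((Finset.Icc ((4 : ℤ) ^ n) (2 * 4 ^ n)).card : ℝ) ≤
      ((Sᶜ ∩ (Finset.Icc ((4 : ℤ) ^ n) (2 * 4 ^ n) : Finset ℤ)).ncard : ℝ)})
    (summable_geometric_of_lt_one hq0.le hq1) (fun n => by
      refine (hq _).trans (pow_le_pow_of_le_one hq0.le hq1.le ?_)
      rw [Int.card_Icc]
      have : (n : ℤ) < 4 ^ n := by exact_mod_cast Nat.lt_pow_self (by norm_num : 1 < 4)
      omega)
  filter_upwards [this] with S hS
  refine mem_bmSet_of_eventually hD0 ?_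
  have h1 : ∀ᶠ n : ℕ in atTop, n ∉ {n : ℕ |
      S ∈ {S : Set ℤ | (1 - D) * ((Finset.Icc ((4 : ℤ) ^ n) (2 * 4 ^ n)).card : ℝ) ≤
      ((Sᶜ ∩ (Finset.Icc ((4 : ℤ) ^ n) (2 * 4 ^ n) : Finset ℤ)).ncard : ℝ)}} := by
    rw [← Nat.cofinite_eq_atTop]
    exact hS.compl_mem_cofinite
  filter_upwards [h1] with n hn
  simp only [not_le] at hn
  set I := Finset.Icc ((4 : ℤ) ^ n) (2 * 4 ^ n)
  have h2 : (S ∩ (I : Set ℤ)).ncard + (Sᶜ ∩ (I : Set ℤ)).ncard = I.card := by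
    rw [← Set.ncard_coe_finset I, Set.inter_comm S, Set.inter_comm Sᶜ, ← Set.sdiff_eq]
    exact Set.ncard_inter_add_ncard_sdiff_eq_ncard _ _ I.finite_toSet
  have h3 : ((S ∩ (I : Set ℤ)).ncard : ℝ) + ((Sᶜ ∩ (I : Set ℤ)).ncard : ℝ) = I.card := by
    exact_mod_cast h2
  linarith

theorem ae_bmDensity_eq (hp0 : 0 ≤ p) (hp1 : p ≤ 1)
    (hp : ∀ F : Finset ℤ, μ.real {S | (F : Set ℤ) ⊆ S} ≤ p ^ F.card)
    (hp' : ∀ F : Finset ℤ, μ.real {S | (F : Set ℤ) ⊆ Sᶜ} ≤ (1 - p) ^ F.card) :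
    ∀ᵐ S ∂μ, bmDensity S = p := by
  have h1 : ∀ᵐ S ∂μ, ∀ k : ℕ, p + 1 / ((k : ℝ) + 1) ∉ bmSet S := ae_all_iff.2 fun k =>
    ae_notMem_bmSet hp0 hp1 hp (by have : 0 < 1 / ((k : ℝ) + 1) := by positivity
                                   linarith)
  have h2 : ∀ᵐ S ∂μ, ∀ k : ℕ, 0 ≤ p - 1 / ((k : ℝ) + 1) → p - 1 / ((k : ℝ) + 1) ∈ bmSet S := by
    refine ae_all_iff.2 fun k => ?_
    by_cases hk : 0 ≤ p - 1 / ((k : ℝ) + 1)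
    · filter_upwards [ae_mem_bmSet hp1 hp' hk
        (by have : 0 < 1 / ((k : ℝ) + 1) := by positivity
            linarith)] with S hS _ using hS
    · exact ae_of_all _ fun S h => absurd h hk
  filter_upwards [h1, h2] with S hS1 hS2
  have hbdd : BddAbove (bmSet S) := ⟨1, fun D hD => bmSet_le_one S hD⟩
  apply le_antisymm
  · refine csSup_le ⟨0, zero_mem_bmSet S⟩ fun D hD => ?_
    by_contra hlt
    obtain ⟨k, hk⟩ := exists_nat_one_div_lt (sub_pos.2 (not_le.1 hlt))
    exact hS1 k (bmSet_anti (by positivity) (by linarith) hD)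
  · refine le_of_forall_pos_le_add fun ε hε => ?_
    obtain ⟨k, hk⟩ := exists_nat_one_div_lt hε
    by_cases h0 : 0 ≤ p - 1 / ((k : ℝ) + 1)
    · have := le_csSup hbdd (hS2 k h0)
      rw [bmDensity]
      linarith
    · have := le_csSup hbdd (zero_mem_bmSet S)
      rw [bmDensity]
      linarith

end Density

/-! ### Transfer to the circle. -/

section Circle

/-- Multiplication by the indicator of `A` on `L²(ℝ / ℤ)`. -/
theorem exists_indicator_projection {A : Set UnitAddCircle}
    (hA : NullMeasurableSet A circleMeasure) :
    ∃ P : Lp ℂ 2 circleMeasure →L[ℂ] Lp ℂ 2 circleMeasure, IsOrthProj P ∧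
      ∀ f : Lp ℂ 2 circleMeasure, P f =ᵐ[circleMeasure] A.indicator f := by
  -- A measurable set equal to `A` almost everywhere defines the same operator.
  obtain ⟨A', -, hA', hAA'⟩ := hA.exists_measurable_superset_ae_eq
  let P₀ : Lp ℂ 2 circleMeasure → Lp ℂ 2 circleMeasure := fun f =>
    ((Lp.memLp f).indicator hA').toLp
  have hP₀ : ∀ f, P₀ f =ᵐ[circleMeasure] A'.indicator f := fun f => MemLp.coeFn_toLp _
  let P₁ : Lp ℂ 2 circleMeasure →ₗ[ℂ] Lp ℂ 2 circleMeasure :=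
    { toFun := P₀
      map_add' := fun f g => by
        refine Lp.ext ?_
        filter_upwards [hP₀ (f + g), hP₀ f, hP₀ g, Lp.coeFn_add f g, Lp.coeFn_add (P₀ f) (P₀ g)]
          with t h1 h2 h3 h4 h5
        rw [h1, h5, Pi.add_apply, h2, h3]
        by_cases ht : t ∈ A'
        · rw [Set.indicator_of_mem ht, Set.indicator_of_mem ht, Set.indicator_of_mem ht, h4,
            Pi.add_apply]
        · simp [ht]
      map_smul' := fun c f => by
        refine Lp.ext ?_
        filter_upwards [hP₀ (c • f), hP₀ f, Lp.coeFn_smul c f, Lp.coeFn_smul c (P₀ f)]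
          with t h1 h2 h3 h4
        rw [h1, RingHom.id_apply, h4, Pi.smul_apply, h2]
        by_cases ht : t ∈ A' <;> simp [ht, h3] }
  let P := P₁.mkContinuous 1 fun f => by
    rw [one_mul]
    refine Lp.norm_le_norm_of_ae_le ?_
    filter_upwards [hP₀ f] with t ht
    change ‖P₀ f t‖ ≤ _
    rw [ht]
    exact norm_indicator_le_norm_self _ _
  have hP : ∀ f, P f =ᵐ[circleMeasure] A'.indicator f := hP₀
  refine ⟨P, ⟨fun f g => ?_, fun f => ?_⟩, fun f => (hP f).trans (indicator_ae_eq_of_ae_eq_set hAA')⟩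
  · rw [L2.inner_def, L2.inner_def]
    refine integral_congr_ae ?_
    filter_upwards [hP f, hP g] with t h1 h2
    rw [h1, h2]
    by_cases ht : t ∈ A' <;> simp [ht]
  · refine Lp.ext ?_
    filter_upwards [hP f, hP (P f)] with t h1 h2
    rw [h2]
    by_cases ht : t ∈ A' <;> simp [ht, h1]

variable {A : Set UnitAddCircle} {P : Lp ℂ 2 circleMeasure →L[ℂ] Lp ℂ 2 circleMeasure}

/-- The indices come out transposed, which determinants do not see. -/
theorem inner_fourierBasis_indicator
    (hP : ∀ f : Lp ℂ 2 circleMeasure, P f =ᵐ[circleMeasure] A.indicator f) (i j : ℤ) :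
    ⟪(fourierBasis (T := 1)) i, P ((fourierBasis (T := 1)) j)⟫_ℂ = toeplitzIndicator A j i := by
  rw [← HilbertBasis.repr_apply_apply, fourierBasis_repr, toeplitzIndicator, Matrix.of_apply,
    fourierCoeff, fourierCoeff, coe_fourierBasis]
  refine integral_congr_ae ?_
  filter_upwards [hP (fourierLp 2 j), coeFn_fourierLp (T := 1) 2 j] with t h1 h2
  rw [h1]
  by_cases ht : t ∈ A
  · rw [Set.indicator_of_mem ht, Set.indicator_of_mem ht, h2, smul_eq_mul, smul_eq_mul, mul_one,
      ← fourier_add]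
    congr 2
    ring
  · rw [Set.indicator_of_notMem ht, Set.indicator_of_notMem ht, smul_zero, smul_zero]

theorem toeplitzIndicator_diag (hA : NullMeasurableSet A circleMeasure) (i : ℤ) :
    toeplitzIndicator A i i = (circleMeasure.real A : ℂ) := by
  rw [toeplitzIndicator, Matrix.of_apply, sub_self, fourierCoeff]
  simp only [neg_zero, fourier_zero, one_smul]
  rw [integral_indicator₀ hA]
  simp

theorem isDeterminantal_iff (hP : IsOrthProj P)
    (hPA : ∀ f : Lp ℂ 2 circleMeasure, P f =ᵐ[circleMeasure] A.indicator f) (μ : Measure (Set ℤ)) :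
    IsDeterminantal μ (toeplitzIndicator A) ↔ IsProbabilityMeasure μ ∧
      ∀ F : Finset ℤ, μ.real {S : Set ℤ | (F : Set ℤ) ⊆ S} =
        realWeight (fourierBasis (T := 1)) P F F := by
  have hb := (fourierBasis (T := 1)).orthonormal
  have key : ∀ F : Finset ℤ, ((toeplitzIndicator A).submatrix (fun i : F => (i : ℤ))
      (fun i : F => (i : ℤ))).det = (realWeight (fourierBasis (T := 1)) P F F : ℂ) := by
    intro F
    rw [coe_realWeight hb hP, weight_self, ← Matrix.det_transpose]
    congr 1
    ext i j
    rw [Matrix.of_apply, inner_fourierBasis_indicator hPA]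
    rfl
  constructor
  · rintro ⟨h1, h2⟩
    exact ⟨h1, fun F => by exact_mod_cast (h2 F).trans (key F)⟩
  · rintro ⟨h1, h2⟩
    exact ⟨h1, fun F => by rw [key, h2]⟩

/-- Duality: a vector orthogonal to `ker P` lies in the range of `P`, so by hypothesis nothing
nonzero is orthogonal to `L`. Thus `L` is dense, and applying `P`, which kills its second summand,
gives a dense subset of `L²(A)`. -/
theorem isCompleteFor_of_inner_eq_zero (hP : IsOrthProj P)
    (hPA : ∀ f : Lp ℂ 2 circleMeasure, P f =ᵐ[circleMeasure] A.indicator f) {S : Set ℤ}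
    (hS : ∀ h, P h = h → (∀ i ∈ S, ⟪(fourierBasis (T := 1)) i, h⟫_ℂ = 0) → h = 0) :
    IsCompleteFor S A := by
  have hb := (fourierBasis (T := 1)).orthonormal
  let b := fourierBasis (T := 1)
  let W : Submodule ℂ (Lp ℂ 2 circleMeasure) := Submodule.span ℂ (b '' S)
  let L := W ⊔ LinearMap.ker P.toLinearMap
  have hL : L.topologicalClosure = ⊤ := by
    rw [Submodule.topologicalClosure_eq_top_iff, Submodule.eq_bot_iff]
    intro g hg
    rw [Submodule.mem_orthogonal] at hg
    have h1 : g - P g = 0 := by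
      have h2 : g - P g ∈ L := Submodule.mem_sup_right (by simp [hP.idem])
      have h3 : ⟪g - P g, P g⟫_ℂ = 0 := by
        rw [← hP.symm, map_sub, hP.idem, sub_self, inner_zero_left]
      rw [← inner_self_eq_zero (𝕜 := ℂ), inner_sub_right, hg _ h2, h3, sub_zero]
    exact hS g (sub_eq_zero.1 h1).symm fun i hi =>
      hg _ (Submodule.mem_sup_left (Submodule.subset_span ⟨i, hi, rfl⟩))
  have hW : ∀ f ∈ W, ∀ n ∉ S, fourierCoeff f n = 0 := by
    intro f hf n hn
    rw [← fourierBasis_repr, HilbertBasis.repr_apply_apply]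
    induction hf using Submodule.span_induction with
    | mem x hx =>
      obtain ⟨i, hi, rfl⟩ := hx
      exact hb.2 (by rintro rfl; exact hn hi)
    | zero => exact inner_zero_right _
    | add x y _ _ hx hy => rw [inner_add_right, hx, hy, add_zero]
    | smul c x _ hx => rw [inner_smul_right, hx, mul_zero]
  rw [IsCompleteFor, Subtype.dense_iff]
  intro h hh
  have hPh : P h = h := by
    refine Lp.ext ?_
    filter_upwards [hPA h, hh] with t h1 h2
    rw [h1]
    by_cases ht : t ∈ A
    · simp [ht]
    · simp [ht, h2 ht]
  have h1 : h ∈ closure (L : Set (Lp ℂ 2 circleMeasure)) := by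
    rw [← Submodule.topologicalClosure_coe, hL]
    trivial
  have h2 : h ∈ closure (P '' L) :=
    image_closure_subset_closure_image P.continuous ⟨h, h1, hPh⟩
  refine closure_mono ?_ h2
  rintro _ ⟨x, hx, rfl⟩
  obtain ⟨f, hf, k, hk, rfl⟩ := Submodule.mem_sup.1 hx
  have hk : P k = 0 := hk
  have hPf : P (f + k) = P f := by rw [map_add, hk, add_zero]
  rw [hPf]
  refine ⟨⟨P f, ?_⟩, ⟨f, hW f hf, hPA f⟩, rfl⟩
  change ∀ᵐ t ∂circleMeasure, t ∉ A → P f t = 0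
  filter_upwards [hPA f] with t h1 h2
  rw [h1, Set.indicator_of_notMem h2]

end Circle

theorem mainTheorem5 (A : Set UnitAddCircle) (hA : NullMeasurableSet A circleMeasure) :
    (∃ S : Set ℤ, bmDensity S = circleMeasure.real A ∧ IsCompleteFor S A) ∧
    (∃! P : Measure (Set ℤ), IsDeterminantal P (toeplitzIndicator A)) ∧
    ∀ P : Measure (Set ℤ), IsDeterminantal P (toeplitzIndicator A) →
      ∀ᵐ S ∂P, IsCompleteFor S A ∧ bmDensity S = circleMeasure.real A := by
  obtain ⟨P, hP, hPA⟩ := exists_indicator_projection hA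
  let b := fourierBasis (T := 1)
  have hb : Orthonormal ℂ b := b.orthonormal
  set p := circleMeasure.real A with hp
  have hp0 : 0 ≤ p := measureReal_nonneg
  have hp1 : p ≤ 1 := measureReal_le_one
  have hdiag : ∀ e, ⟪b e, P (b e)⟫_ℂ = p := fun e => by
    rw [inner_fourierBasis_indicator hPA, toeplitzIndicator_diag hA]
  have hdiag' : ∀ e, ⟪b e, (1 - P) (b e)⟫_ℂ = ((1 - p : ℝ) : ℂ) := fun e => by
    change ⟪b e, b e - P (b e)⟫_ℂ = _
    rw [inner_sub_right, hdiag, inner_self_eq_norm_sq_to_K, hb.1]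
    simp
  have hae : ∀ μ : Measure (Set ℤ), IsDeterminantal μ (toeplitzIndicator A) →
      ∀ᵐ S ∂μ, IsCompleteFor S A ∧ bmDensity S = p := by
    intro μ hμ
    obtain ⟨hμ1, hμ2⟩ := (isDeterminantal_iff hP hPA μ).1 hμ
    filter_upwards [ae_eq_zero_of_inner_eq_zero b hP hμ2,
      ae_bmDensity_eq hp0 hp1
        (fun F => (hμ2 F).trans_le (realWeight_self_le_pow hb hP hp0 hp1 hdiag F))
        (fun F => (measureReal_disjoint hb hμ2 F).trans_le
          (realWeight_self_le_pow hb hP.one_sub (by linarith) (by linarith) hdiag' F))] with S h1 h2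
    exact ⟨isCompleteFor_of_inner_eq_zero hP hPA h1, h2⟩
  obtain ⟨μ, hμ1, hμ2⟩ := exists_measure_realWeight hb hP
  have hμ := (isDeterminantal_iff hP hPA μ).2 ⟨hμ1, hμ2⟩
  refine ⟨?_, ⟨μ, hμ, fun ν hν => ?_⟩, hae⟩
  · obtain ⟨S, hS1, hS2⟩ := (hae μ hμ).exists
    exact ⟨S, hS2, hS1⟩
  · obtain ⟨hν1, hν2⟩ := (isDeterminantal_iff hP hPA ν).1 hν
    exact measure_ext_of_subset_mem fun F => (hν2 F).trans (hμ2 F).symm
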